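/- Let $k$ be a field of characteristic $2$, let $m,n\ge 1$ be integers, let $D\in k^{n\times n}$ be a nonsingular diagonal matrix, and let $M=0_m\oplus D\in k^{(m+n)\times(m+n)}$ be the block diagonal matrix with blocks the $m\times m$ zero matrix $0_m$ and $D$. For a square matrix $N$ write $\mathfrak{o}(N)=\{X : X^tN+NX=0\}$, a Lie algebra under the commutator. For a Lie algebra $\mathfrak{g}$ write $\mathfrak{rad}(\mathfrak{g})$ for its radical, $\mathfrak{g}^{\mathrm{ss}}=\mathfrak{g}/\mathfrak{rad}(\mathfrak{g})$, and $\mathfrak{g}^{(i)}$ for its $i$-th derived subalgebra ($\mathfrak{g}^{(0)}=\mathfrak{g}$, $\mathfrak{g}^{(i+1)}=[\mathfrak{g}^{(i)},\mathfrak{g}^{(i)}]$). Let $\mathfrak{gl}_r$ be the Lie algebra of all $r\times r$ matrices over $k$, $\mathfrak{sl}_r\subseteq\mathfrak{gl}_r$ the subalgebra of matrices of trace zero, $\mathbb{I}_r$ the identity matrix and $\mathfrak{pgl}_r=\mathfrak{gl}_r/k\mathbb{I}_r$. For a subalgebra $\mathfrak{g}$ of $\mathfrak{gl}_r$ let $\mathbb{V}_{\mathfrak{g}}=k^r$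 be the restriction of the vector representation, and let $k_1$ be the representation of $\mathfrak{gl}_1=k$ on $k$ by multiplication. If $V$, $W$ are representations of $\mathfrak{g}$, $\mathfrak{h}$ respectively, then $\mathfrak{g}\oplus\mathfrak{h}$ acts on $\mathrm{Hom}(W,V)$ by $((x,y)\cdot\phi)(w)=x\cdot\phi(w)-\phi(y\cdot w)$. For a representation $U$ of a Lie algebra $\mathfrak{a}$, $\mathfrak{a}\ltimes U$ is the semidirect product in which $U$ is an abelian ideal. All isomorphisms are isomorphisms of Lie algebras over $k$. (a) The radical of $\mathfrak{o}(M)$ is $$\mathfrak{rad}(\mathfrak{o}(M))\cong\begin{cases}\mathfrak{o}(M) & \text{if } m,n\le 2,\\ (\mathfrak{gl}_1\oplus\mathfrak{o}(D))\ltimes\mathrm{Hom}(\mathbb{V}_{\mathfrak{o}(D)},k_1^{\oplus m}) & \text{if } m\ge 3,\ n\le 2,\\ (\mathfrak{gl}_m\oplus\mathfrak{gl}_1)\ltimes\mathrm{Hom}(k_1^{\oplus n},\mathbb{V}_{\mathfrak{gl}_m}) & \text{if } m\le 2,\ n\ge 3,\\ (\mathfrak{gl}_1\oplus\mathfrak{gl}_1)\ltimes\mathrm{Hom}(k_1^{\oplus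 n},k_1^{\oplus m}) & \text{if } m,n\ge 3.\end{cases}$$ (b) $\mathfrak{o}(M)^{\mathrm{ss}}\cong\mathfrak{gl}_m^{\mathrm{ss}}\oplus\mathfrak{o}(D)^{\mathrm{ss}}$. In particular, if $m,n\ge 3$ then $$\mathfrak{o}(M)^{\mathrm{ss}}\cong\begin{cases}\mathfrak{pgl}_m\oplus\mathfrak{o}(D)/k\mathbb{I}_n & \text{if } 2\mid m,\\ \mathfrak{sl}_m\oplus\mathfrak{o}(D)/k\mathbb{I}_n & \text{if } 2\nmid m.\end{cases}$$ (c) If $m\ge 3$ or $n\ge 3$, then for every $i\ge 1$ $$\mathfrak{o}(M)^{(i)}\cong\left(\mathfrak{sl}_m^{(i-1)}\oplus\mathfrak{o}(D)^{(i)}\right)\ltimes\mathrm{Hom}\left(\mathbb{V}_{\mathfrak{o}(D)^{(i)}},\mathbb{V}_{\mathfrak{sl}_m^{(i-1)}}\right).$$ In particular, if $m,n\ge 3$ then $$\mathfrak{o}(M)^{(1)}\cong\left(\mathfrak{sl}_m\oplus\mathfrak{o}(D)^{(1)}\right)\ltimes\mathrm{Hom}\left(\mathbb{V}_{\mathfrak{o}(D)^{(1)}},\mathbb{V}_{\mathfrak{sl}_m}\right)\quad\text{and}\quad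 \mathfrak{o}(M)^{(2)}=\mathfrak{o}(M)^{(1)}.$$ (d) $\mathfrak{o}(M)$ is solvable if and only if $m,n\le 2$. -/

import Mathlib

open scoped Matrix

/- Commutator bracket on associative algebras; it provides `𝔤𝔩ₙ` (all square matrices) and
`Module.End k V` with their standard Lie algebra structure. -/
attribute [local instance] LieRing.ofAssociativeRing

noncomputable section

namespace DegForm

/-! ### Matrix Lie algebras -/

/-- `𝔤𝔩ₙ`, the Lie algebra of all `n × n` matrices with the commutator bracket. -/
abbrev gl (k : Type*) (n : ℕ) : Type _ := Matrix (Fin n) (Fin n) k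

/-- `𝔰𝔩ₙ`, the Lie subalgebra of matrices of trace zero. -/
abbrev sl (k : Type*) [Field k] (n : ℕ) : LieSubalgebra k (gl k n) :=
  LieAlgebra.SpecialLinear.sl (Fin n) k

/-- `𝔬(M)`, the Lie algebra of the matrices `X` with `Xᵀ M + M X = 0`
(see `mem_formLie` for the equation in this shape). -/
abbrev formLie {k : Type*} [Field k] {ι : Type*} [Fintype ι] [DecidableEq ι] (M : Matrix ι ι k) :
    LieSubalgebra k (Matrix ι ι k) :=
  skewAdjointMatricesLieSubalgebra M

theorem mem_formLie {k : Type*} [Field k] {ι : Type*} [Fintype ι] [DecidableEq ι]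
    (M X : Matrix ι ι k) : X ∈ formLie M ↔ Xᵀ * M + M * X = 0 := by
  rw [formLie, mem_skewAdjointMatricesLieSubalgebra, mem_skewAdjointMatricesSubmodule]
  change Xᵀ * M = M * (-X) ↔ _
  rw [Matrix.mul_neg, eq_neg_iff_add_eq_zero]

/-- The block diagonal matrix `0ₘ ⊕ D`, of size `m + n`. -/
abbrev zeroSum {k : Type*} [Field k] (m : ℕ) {n : ℕ} (D : Matrix (Fin n) (Fin n) k) :
    Matrix (Fin m ⊕ Fin n) (Fin m ⊕ Fin n) k :=
  Matrix.fromBlocks 0 0 0 D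

/-- The Lie ideal `k 𝕀ₙ` of scalar matrices in `𝔤𝔩ₙ`. -/
def scalars (k : Type*) [Field k] (n : ℕ) : LieIdeal k (gl k n) where
  carrier := {X | ∃ c : k, X = c • (1 : Matrix (Fin n) (Fin n) k)}
  zero_mem' := ⟨0, by simp⟩
  add_mem' := by
    rintro _ _ ⟨a, rfl⟩ ⟨b, rfl⟩
    exact ⟨a + b, by rw [add_smul]⟩
  smul_mem' := by
    rintro t _ ⟨a, rfl⟩
    exact ⟨t * a, by rw [mul_smul]⟩
  lie_mem := by
    rintro X _ ⟨a, rfl⟩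
    exact ⟨0, by simp [Ring.lie_def]⟩

/-- `𝔭𝔤𝔩ₙ = 𝔤𝔩ₙ / k 𝕀ₙ`. -/
abbrev pgl (k : Type*) [Field k] (n : ℕ) : Type _ := gl k n ⧸ scalars k n

/-- The Lie ideal of scalar matrices contained in `𝔬(D)`. In characteristic two it is all of
`k 𝕀ₙ`, see `one_mem_formLie`. -/
abbrev formScalars {k : Type*} [Field k] {n : ℕ} (D : Matrix (Fin n) (Fin n) k) :
    LieIdeal k (formLie D) :=
  LieIdeal.comap (formLie D).incl (scalars k n)

theorem one_mem_formLie {k : Type*} [Field k] [CharP k 2] {n : ℕ}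
    (D : Matrix (Fin n) (Fin n) k) : (1 : Matrix (Fin n) (Fin n) k) ∈ formLie D := by
  rw [mem_formLie, Matrix.transpose_one, Matrix.one_mul, Matrix.mul_one]
  ext i j
  exact CharTwo.add_self_eq_zero _

/-- `𝔤ˢˢ = 𝔤 / 𝔯𝔞𝔡(𝔤)`. -/
abbrev SSQuot (k : Type*) [Field k] (L : Type*) [LieRing L] [LieAlgebra k L] : Type _ :=
  L ⧸ LieAlgebra.radical k L

/-! ### Representations, as Lie algebra homomorphisms to `End V` -/

section Representations

variable {k : Type*} [Field k]

/-- The vector representation of `𝔤𝔩ₙ` on `kⁿ`. -/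
def vecGL (k : Type*) [Field k] (n : ℕ) : gl k n →ₗ⁅k⁆ Module.End k (Fin n → k) :=
  LieModule.toEnd k (gl k n) (Fin n → k)

/-- The restriction of the vector representation to a subalgebra of `𝔤𝔩ₙ`. -/
def vecRes {n : ℕ} (g : LieSubalgebra k (gl k n)) : g →ₗ⁅k⁆ Module.End k (Fin n → k) :=
  (vecGL k n).comp g.incl

/-- The restriction of the vector representation to the `i`-th derived subalgebra of a
subalgebra of `𝔤𝔩ₙ`. -/
def vecDer {n : ℕ} (g : LieSubalgebra k (gl k n)) (i : ℕ) :
    LieAlgebra.derivedSeries k g i →ₗ⁅k⁆ Module.End k (Fin n → k) :=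
  (vecRes g).comp (LieAlgebra.derivedSeries k g i).incl

/-- The representation `k_c` of `𝔤𝔩₁` on `k` in which `1` acts as multiplication by `c`. -/
def charRep (c : k) : gl k 1 →ₗ⁅k⁆ Module.End k k where
  toFun x := (x 0 0 * c) • (1 : Module.End k k)
  map_add' x y := by simp [add_mul, add_smul]
  map_smul' t x := by simp [mul_assoc, mul_smul]
  map_lie' := by
    intro x y
    have h1 : ⁅x, y⁆ 0 0 = 0 := by
      simp [Ring.lie_def, Matrix.mul_apply, mul_comm (x 0 0) (y 0 0)]
    change (⁅x, y⁆ 0 0 * c) • (1 : Module.End k k) = _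
    rw [h1, zero_mul, zero_smul, Ring.lie_def]
    ext
    simp
    ring

variable {g h : Type*} [LieRing g] [LieAlgebra k g] [LieRing h] [LieAlgebra k h]
variable {V W : Type*} [AddCommGroup V] [Module k V] [AddCommGroup W] [Module k W]

/-- The `r`-fold direct sum `V^{⊕ r}` of a representation `V`. -/
def powRep (ρ : g →ₗ⁅k⁆ Module.End k V) (r : ℕ) : g →ₗ⁅k⁆ Module.End k (Fin r → V) where
  toFun x := (ρ x).compLeft (Fin r)
  map_add' x y := by ext; simp
  map_smul' t x := by ext; simp
  map_lie' := by
    intro x y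
    refine LinearMap.ext fun v => funext fun i => ?_
    simp [Ring.lie_def]

/-- `Hom(W, V)` as a representation of `g ⊕ h`, where `g` acts on `V` by `ρ` and `h` acts on `W`
by `σ`: `(x, y) · φ = x ∘ φ - φ ∘ y`. -/
def homRep (σ : h →ₗ⁅k⁆ Module.End k W) (ρ : g →ₗ⁅k⁆ Module.End k V) :
    g × h →ₗ⁅k⁆ Module.End k (W →ₗ[k] V) where
  toFun p :=
    { toFun := fun φ => (ρ p.1).comp φ - φ.comp (σ p.2)
      map_add' := fun φ ψ => by
        ext w
        simp only [LinearMap.sub_apply, LinearMap.comp_apply, LinearMap.add_apply, map_add]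
        abel
      map_smul' := fun t φ => by
        ext w
        simp [smul_sub] }
  map_add' p q := by
    ext φ w
    simp
    abel
  map_smul' t p := by
    ext φ w
    simp [smul_sub]
  map_lie' := by
    intro p q
    ext φ w
    simp [Ring.lie_def]
    abel

/-! ### The semidirect product of a Lie algebra and a representation -/

/-- The vector space `V` considered as an abelian Lie algebra. -/
def AbelianLie (V : Type*) : Type _ := V

instance : AddCommGroup (AbelianLie V) := inferInstanceAs (AddCommGroup V)

instance : Module k (AbelianLie V) := inferInstanceAs (Module k V)

instance : LieRing (AbelianLie V) where
  bracket _ _ := 0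
  add_lie _ _ _ := (add_zero 0).symm
  lie_add _ _ _ := (add_zero 0).symm
  lie_self _ := rfl
  leibniz_lie _ _ _ := (add_zero 0).symm

instance : LieAlgebra k (AbelianLie V) where
  lie_smul t _ _ := (smul_zero t).symm

/-- A representation on `V` is an action by derivations on the abelian Lie algebra `V`. -/
def repDer (ρ : g →ₗ⁅k⁆ Module.End k V) :
    g →ₗ⁅k⁆ LieDerivation k (AbelianLie V) (AbelianLie V) where
  toFun x :=
    { toLinearMap := (ρ x : V →ₗ[k] V)
      leibniz' := fun a b => by
        change ρ x (0 : V) = (0 : V) - 0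
        rw [map_zero, sub_zero] }
  map_add' x y := by
    ext v
    exact congrArg (fun f : Module.End k V => f v) (map_add ρ x y)
  map_smul' t x := by
    ext v
    exact congrArg (fun f : Module.End k V => f v) (map_smul ρ t x)
  map_lie' := by
    intro x y
    ext v
    exact congrArg (fun f : Module.End k V => f v) (LieHom.map_lie ρ x y)

/-- The semidirect product `g ⋉ V` of a Lie algebra `g` and a representation `ρ` of `g` on `V`,
with bracket `[(v, x), (w, y)] = (x · w - y · v, [x, y])`. -/
abbrev Semi (ρ : g →ₗ⁅k⁆ Module.End k V) : Type _ :=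
  LieAlgebra.SemiDirectSum (AbelianLie V) g (repDer ρ)

theorem semi_lie (ρ : g →ₗ⁅k⁆ Module.End k V) (v w : V) (x y : g) :
    (⁅(⟨v, x⟩ : Semi ρ), (⟨w, y⟩ : Semi ρ)⁆ : Semi ρ) = ⟨ρ x w - ρ y v, ⁅x, y⁆⟩ := by
  rw [LieAlgebra.SemiDirectSum.lie_eq_mk]
  congr 1
  change (0 : V) + ρ x w - ρ y v = _
  rw [zero_add]

end Representations

end DegForm

end

/-!
Why the theorem is true. Since `D` is invertible, the equation `XᵗM + MX = 0` for `M = 0ₘ ⊕ D` says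
that `X` is block upper triangular with diagonal blocks `A ∈ 𝔤𝔩ₘ` and `E ∈ 𝔬(D)` and an arbitrary
upper right block `B` (`fromBlocks_mem_formLie_iff`). So `𝔬(M)` is an extension of `𝔤𝔩ₘ ⊕ 𝔬(D)` by
the abelian ideal `Hom(kⁿ, kᵐ)`, and any ideal described by conditions on `A` and `E` alone is a
semidirect product of the expected kind (`nonempty_idealEquiv_semi`).

* The radical of `𝔬(M)` is the preimage of the radicals of `𝔤𝔩ₘ` and `𝔬(D)`, because the common
  kernel of the two projections is abelian (`mem_radical_formLie_zeroSum_iff`).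
* If `m ≥ 3` or `n ≥ 3`, the ideal `Hom(kⁿ, kᵐ)` survives in every derived subalgebra
  (`inclHom_mem_derivedSeries`), so that the `i`-th derived subalgebra is again the preimage of those
  of `𝔤𝔩ₘ` and `𝔬(D)` (`mem_derivedSeries_formLie_zeroSum_iff`).

It remains to study the two diagonal blocks. For sizes at most two both are solvable, which for
`𝔤𝔩₂` needs characteristic two. For size at least three, an ideal with a non-scalar element contains
all elementary matrices off the diagonal, respectively all `dⱼ Eᵢⱼ + dᵢ Eⱼᵢ` with `i ≠ j`: in
characteristic two `𝔬(D)` contains the diagonal matrices, and brackets with them isolate the entries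
of a matrix. The span of these elements reproduces itself under the bracket when there is a third
index, so such an ideal is not solvable. Therefore the radicals consist of the scalar matrices
(`mem_radical_gl_iff`, `mem_radical_formLie_iff`), and the first derived subalgebras are perfect.
-/

noncomputable section

namespace DegForm

/-! ### Ideals, radicals and derived series under Lie algebra homomorphisms -/

section General

variable {k L L' : Type*} [Field k] [LieRing L] [LieAlgebra k L] [LieRing L'] [LieAlgebra k L']

/-- An injective homomorphism whose image is the ideal `I` identifies its source with `I`. -/
theorem nonempty_idealEquiv (f : L' →ₗ⁅k⁆ L) (hf : Function.Injective f) (I : LieIdeal k L)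
    (h : ∀ x, x ∈ I ↔ ∃ y, f y = x) : Nonempty (I ≃ₗ⁅k⁆ L') := by
  have hmem : ∀ y, f y ∈ I := fun y => (h _).2 ⟨y, rfl⟩
  let g : L' →ₗ⁅k⁆ I :=
    { toFun := fun y => ⟨f y, hmem y⟩
      map_add' := fun x y => Subtype.ext (map_add f x y)
      map_smul' := fun t x => Subtype.ext (map_smul f t x)
      map_lie' := fun {x y} => Subtype.ext (LieHom.map_lie f x y) }
  have hg : Function.Bijective g := by
    constructor
    · intro x y hxy
      exact hf (congrArg Subtype.val hxy)
    · rintro ⟨x, hx⟩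
      obtain ⟨y, rfl⟩ := (h x).1 hx
      exact ⟨y, rfl⟩
  exact ⟨(LieEquiv.ofBijective g hg).symm⟩

/-- The first isomorphism theorem for a surjective homomorphism with kernel `I`. -/
theorem nonempty_quotEquiv (f : L →ₗ⁅k⁆ L') (hf : Function.Surjective f) (I : LieIdeal k L)
    (h : ∀ x, x ∈ I ↔ f x = 0) : Nonempty ((L ⧸ I) ≃ₗ⁅k⁆ L') := by
  obtain rfl : I = f.ker := by
    ext x
    rw [h, LieHom.mem_ker]
  have hr : f.range = ⊤ := (LieHom.range_eq_top f).2 hf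
  exact ⟨f.quotKerEquivRange.trans
    ((LieEquiv.ofEq _ _ (congrArg _ hr)).trans LieSubalgebra.topEquiv)⟩

/-- The quotient map by an ideal, as a homomorphism of Lie algebras. -/
def quotHom (I : LieIdeal k L) : L →ₗ⁅k⁆ L ⧸ I where
  toLinearMap := I.toSubmodule.mkQ
  map_lie' := rfl

theorem quotHom_surjective (I : LieIdeal k L) : Function.Surjective (quotHom I) :=
  Submodule.mkQ_surjective _

theorem mem_iff_quotHom_eq_zero (I : LieIdeal k L) (x : L) : x ∈ I ↔ quotHom I x = 0 :=
  LieSubmodule.Quotient.mk_eq_zero'.symm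

theorem derivedSeriesOfIdeal_comap_le (f : L →ₗ⁅k⁆ L') (J : LieIdeal k L') (s : ℕ) :
    LieAlgebra.derivedSeriesOfIdeal k L s (LieIdeal.comap f J) ≤
      LieIdeal.comap f (LieAlgebra.derivedSeriesOfIdeal k L' s J) := by
  induction s with
  | zero => exact le_rfl
  | succ s ih =>
    rw [LieAlgebra.derivedSeriesOfIdeal_succ, LieAlgebra.derivedSeriesOfIdeal_succ,
      LieSubmodule.lie_le_iff]
    intro x hx y hy
    rw [LieIdeal.mem_comap, LieHom.map_lie]
    exact LieSubmodule.lie_mem_lie (ih hx) (ih hy)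

theorem map_mem_derivedSeries (f : L →ₗ⁅k⁆ L') {s : ℕ} {x : L}
    (hx : x ∈ LieAlgebra.derivedSeries k L s) : f x ∈ LieAlgebra.derivedSeries k L' s :=
  derivedSeriesOfIdeal_comap_le f ⊤ s hx

theorem isSolvable_ideal_iff (I : LieIdeal k L) :
    LieAlgebra.IsSolvable I ↔ ∃ s, LieAlgebra.derivedSeriesOfIdeal k L s I = ⊥ := by
  rw [LieAlgebra.isSolvable_iff k]
  exact exists_congr fun s => LieIdeal.derivedSeries_eq_bot_iff I s

theorem map_derivedSeriesOfIdeal (f : L →ₗ⁅k⁆ L') (hf : Function.Surjective f) (I : LieIdeal k L)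
    (s : ℕ) : LieIdeal.map f (LieAlgebra.derivedSeriesOfIdeal k L s I) =
      LieAlgebra.derivedSeriesOfIdeal k L' s (LieIdeal.map f I) := by
  induction s with
  | zero => rfl
  | succ s ih =>
    rw [LieAlgebra.derivedSeriesOfIdeal_succ, LieAlgebra.derivedSeriesOfIdeal_succ,
      LieIdeal.map_bracket_eq f hf, ih]

/-- A surjective homomorphism carries the radical into the radical. -/
theorem map_mem_radical [IsNoetherian k L] [IsNoetherian k L'] (f : L →ₗ⁅k⁆ L')
    (hf : Function.Surjective f) {x : L} (hx : x ∈ LieAlgebra.radical k L) :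
    f x ∈ LieAlgebra.radical k L' := by
  have h : LieAlgebra.IsSolvable (LieIdeal.map f (LieAlgebra.radical k L)) := by
    obtain ⟨s, hs⟩ := (isSolvable_ideal_iff (LieAlgebra.radical k L)).1 inferInstance
    refine (isSolvable_ideal_iff _).2 ⟨s, ?_⟩
    rw [← map_derivedSeriesOfIdeal f hf, hs, LieIdeal.map_eq_bot_iff]
    exact bot_le
  exact (LieAlgebra.LieIdeal.solvable_iff_le_radical k L' _).1 h (LieIdeal.mem_map hx)

/-- If the common kernel of two surjections `f : L → L₁` and `f' : L → L₂` is abelian, then the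
radical of `L` is cut out by the radicals of `L₁` and `L₂`. -/
theorem mem_radical_iff_of_pair {L₁ L₂ : Type*} [LieRing L₁] [LieAlgebra k L₁] [LieRing L₂]
    [LieAlgebra k L₂] [IsNoetherian k L] [IsNoetherian k L₁] [IsNoetherian k L₂]
    (f : L →ₗ⁅k⁆ L₁) (f' : L →ₗ⁅k⁆ L₂) (hf : Function.Surjective f) (hf' : Function.Surjective f')
    (hker : ∀ x y, f x = 0 → f' x = 0 → f y = 0 → f' y = 0 → ⁅x, y⁆ = 0) (x : L) :
    x ∈ LieAlgebra.radical k L ↔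
      f x ∈ LieAlgebra.radical k L₁ ∧ f' x ∈ LieAlgebra.radical k L₂ := by
  refine ⟨fun hx => ⟨map_mem_radical f hf hx, map_mem_radical f' hf' hx⟩, fun hx => ?_⟩
  set K : LieIdeal k L := LieIdeal.comap f (LieAlgebra.radical k L₁) ⊓
    LieIdeal.comap f' (LieAlgebra.radical k L₂) with hK
  have hxK : x ∈ K := hx
  refine (LieAlgebra.LieIdeal.solvable_iff_le_radical k L K).1 ?_ hxK
  obtain ⟨s, hs⟩ := (isSolvable_ideal_iff (LieAlgebra.radical k L₁)).1 inferInstance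
  obtain ⟨t, ht⟩ := (isSolvable_ideal_iff (LieAlgebra.radical k L₂)).1 inferInstance
  have h₁ : ∀ y ∈ LieAlgebra.derivedSeriesOfIdeal k L (s + t) K, f y = 0 := by
    intro y hy
    have h := derivedSeriesOfIdeal_comap_le f _ s
      (LieAlgebra.derivedSeriesOfIdeal_le (inf_le_left : K ≤ _) (Nat.le_add_right s t) hy)
    rwa [hs] at h
  have h₂ : ∀ y ∈ LieAlgebra.derivedSeriesOfIdeal k L (s + t) K, f' y = 0 := by
    intro y hy
    have h := derivedSeriesOfIdeal_comap_le f' _ t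
      (LieAlgebra.derivedSeriesOfIdeal_le (inf_le_right : K ≤ _) (Nat.le_add_left t s) hy)
    rwa [ht] at h
  refine (isSolvable_ideal_iff K).2 ⟨s + t + 1, ?_⟩
  rw [LieAlgebra.derivedSeriesOfIdeal_succ, LieSubmodule.lie_eq_bot_iff]
  exact fun y hy z hz => hker y z (h₁ y hy) (h₂ y hy) (h₁ z hz) (h₂ z hz)

theorem isSolvable_iff_forall_mem_radical [IsNoetherian k L] :
    LieAlgebra.IsSolvable L ↔ ∀ x, x ∈ LieAlgebra.radical k L := by
  constructor
  · intro h x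
    rw [LieAlgebra.radical_eq_top_of_isSolvable]
    trivial
  · intro h
    have ht : LieAlgebra.radical k L = ⊤ := by
      ext x
      simp [h x]
    have hs : LieAlgebra.IsSolvable (⊤ : LieIdeal k L) := ht ▸ inferInstance
    rw [isSolvable_ideal_iff] at hs
    exact (LieAlgebra.isSolvable_iff k L).2 hs

/-- If a Lie subalgebra `S` of `L` is equal to the first derived subalgebra, then the derived series
of `L` continues as that of `S`. -/
theorem mem_derivedSeries_succ_iff (S : LieSubalgebra k L)
    (hS : ∀ x, x ∈ LieAlgebra.derivedSeries k L 1 ↔ x ∈ S) (i : ℕ) (x : L) :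
    x ∈ LieAlgebra.derivedSeries k L (i + 1) ↔
      ∃ y ∈ LieAlgebra.derivedSeries k S i, (y : L) = x := by
  suffices h : (LieAlgebra.derivedSeries k L (i + 1)).toSubmodule =
      Submodule.map (S.incl : S →ₗ[k] L) (LieAlgebra.derivedSeries k S i).toSubmodule by
    rw [← LieSubmodule.mem_toSubmodule, h]
    rfl
  induction i with
  | zero =>
    ext x
    rw [LieSubmodule.mem_toSubmodule, hS]
    exact ⟨fun hx => ⟨⟨x, hx⟩, trivial, rfl⟩, fun ⟨y, _, hy⟩ => hy ▸ y.2⟩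
  | succ i ih =>
    have ih' : ∀ x, x ∈ LieAlgebra.derivedSeries k L (i + 1) ↔
        ∃ y ∈ LieAlgebra.derivedSeries k S i, (y : L) = x := by
      intro x
      rw [← LieSubmodule.mem_toSubmodule, ih]
      rfl
    have hD : ∀ (M : Type _) [LieRing M] [LieAlgebra k M] (s : ℕ),
        LieAlgebra.derivedSeries k M (s + 1) =
          ⁅LieAlgebra.derivedSeries k M s, LieAlgebra.derivedSeries k M s⁆ :=
      fun M _ _ s => LieAlgebra.derivedSeriesOfIdeal_succ k M ⊤ s
    rw [hD L (i + 1), hD S i,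
      LieSubmodule.lieIdeal_oper_eq_linear_span', LieSubmodule.lieIdeal_oper_eq_linear_span',
      Submodule.map_span]
    congr 1
    ext z
    constructor
    · rintro ⟨x, hx, y, hy, rfl⟩
      obtain ⟨x', hx', rfl⟩ := (ih' x).1 hx
      obtain ⟨y', hy', rfl⟩ := (ih' y).1 hy
      exact ⟨⁅x', y'⁆, ⟨x', hx', y', hy', rfl⟩, rfl⟩
    · rintro ⟨_, ⟨x, hx, y, hy, rfl⟩, rfl⟩
      exact ⟨x, (ih' _).2 ⟨x, hx, rfl⟩, y, (ih' _).2 ⟨y, hy, rfl⟩, rfl⟩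

/-- A property of ideals that passes from `I` to `⁅I, I⁆` and excludes the zero ideal
obstructs solvability. -/
theorem not_isSolvable_of_lie_self (P : LieIdeal k L → Prop) (hP : ∀ I, P I → P ⁅I, I⁆)
    (hbot : ¬ P ⊥) (I : LieIdeal k L) (hI : P I) : ¬ LieAlgebra.IsSolvable I := by
  rw [isSolvable_ideal_iff]
  rintro ⟨s, hs⟩
  refine hbot (hs ▸ ?_)
  clear hs
  induction s with
  | zero => exact hI
  | succ s ih =>
    rw [LieAlgebra.derivedSeriesOfIdeal_succ]
    exact hP _ ih

theorem isSolvable_of_derivedSeries_two_central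
    (h : ∀ x ∈ LieAlgebra.derivedSeries k L 2, ∀ y : L, ⁅x, y⁆ = 0) : LieAlgebra.IsSolvable L := by
  rw [LieAlgebra.isSolvable_iff k L]
  refine ⟨3, ?_⟩
  rw [LieAlgebra.derivedSeries_def, LieAlgebra.derivedSeriesOfIdeal_succ,
    LieSubmodule.lie_eq_bot_iff]
  exact fun x hx y _ => h x hx y

end General

/-! ### The general linear Lie algebra -/

section GeneralLinear

open Matrix

variable {k : Type*} [Field k] {m : ℕ}

theorem exists_third (hm : 3 ≤ m) (i j : Fin m) : ∃ l, l ≠ i ∧ l ≠ j :=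
  Fin.exists_ne_and_ne_of_two_lt i j hm

theorem lie_single_single_of_ne {i j l : Fin m} (h : l ≠ i) (a b : k) :
    ⁅single i j a, single j l b⁆ = single i l (a * b) := by
  rw [Ring.lie_def, single_mul_single_same, single_mul_single_of_ne _ _ _ _ h, sub_zero]

/-- The ideal contains all elementary matrices off the diagonal. -/
def ContainsOffDiag (I : LieIdeal k (gl k m)) : Prop :=
  ∀ p q : Fin m, p ≠ q → single p q (1 : k) ∈ I

theorem ContainsOffDiag.lie_self (hm : 3 ≤ m) {I : LieIdeal k (gl k m)} (hI : ContainsOffDiag I) :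
    ContainsOffDiag ⁅I, I⁆ := by
  intro p q hpq
  obtain ⟨r, hrp, hrq⟩ := exists_third hm p q
  have h := LieSubmodule.lie_mem_lie (hI p r hrp.symm) (hI r q hrq)
  rwa [lie_single_single_of_ne hpq.symm, one_mul] at h

theorem not_isSolvable_of_containsOffDiag (hm : 3 ≤ m) {I : LieIdeal k (gl k m)}
    (hI : ContainsOffDiag I) : ¬ LieAlgebra.IsSolvable I := by
  refine not_isSolvable_of_lie_self ContainsOffDiag (fun J hJ => hJ.lie_self hm) ?_ I hI
  intro h
  have h01 := h ⟨0, by omega⟩ ⟨1, by omega⟩ (by simp)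
  rw [LieSubmodule.mem_bot] at h01
  simpa using congrFun (congrFun h01 ⟨0, by omega⟩) ⟨1, by omega⟩

theorem containsOffDiag_derivedSeries (hm : 3 ≤ m) (s : ℕ) :
    ContainsOffDiag (LieAlgebra.derivedSeries k (gl k m) s) := by
  induction s with
  | zero => exact fun _ _ _ => trivial
  | succ s ih =>
    rw [LieAlgebra.derivedSeries_def, LieAlgebra.derivedSeriesOfIdeal_succ]
    exact ih.lie_self hm

/-- One elementary matrix off the diagonal generates, as an ideal, all of them. -/
theorem containsOffDiag_of_single_mem (hm : 3 ≤ m) {I : LieIdeal k (gl k m)} {i j : Fin m}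
    (h : single i j (1 : k) ∈ I) : ContainsOffDiag I := by
  have hrow : ∀ {a b c : Fin m}, c ≠ a → single a b (1 : k) ∈ I → single a c (1 : k) ∈ I := by
    intro a b c hca hab
    have := lie_mem_left k (gl k m) I _ (single b c 1) hab
    rwa [lie_single_single_of_ne hca, one_mul] at this
  have hcol : ∀ {a b c : Fin m}, c ≠ b → single a b (1 : k) ∈ I → single c b (1 : k) ∈ I := by
    intro a b c hcb hab
    have := lie_mem_right k (gl k m) I (single c a 1) _ hab
    rwa [lie_single_single_of_ne hcb.symm, one_mul] at this
  intro p q hpq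
  obtain ⟨r, hri, hrp⟩ := exists_third hm i p
  exact hrow hpq.symm (hcol hrp.symm (hrow hri h))

theorem containsOffDiag_of_apply_ne_zero (hm : 3 ≤ m) {I : LieIdeal k (gl k m)} {X : gl k m}
    (hX : X ∈ I) {i j : Fin m} (hij : i ≠ j) (h : X i j ≠ 0) : ContainsOffDiag I := by
  obtain ⟨l, hli, hlj⟩ := exists_third hm i j
  refine containsOffDiag_of_single_mem (i := i) (j := l) hm ?_
  -- Brackets with `Eᵢᵢ` and `Eⱼⱼ` leave only the entries `(i, j)` and `(j, i)` of `X`; the bracket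
  -- with `Eⱼₗ` then removes the second one, without any assumption on the characteristic.
  have h₁ := lie_mem_right k (gl k m) I (single i i 1) _ hX
  have h₂ := lie_mem_left k (gl k m) I _ (single j j 1) h₁
  have h₃ := lie_mem_left k (gl k m) I _ (single j l 1) h₂
  have h₄ := I.smul_mem (X i j)⁻¹ h₃
  have key : ∀ e f g : gl k m, ⁅⁅⁅e, X⁆, f⁆, g⁆ = e * X * (f * g) - X * (e * f) * g -
      (f * e) * X * g + f * X * (e * g) - (g * e) * X * f + g * X * (e * f) + (g * f) * e * X -
      (g * f) * X * e := by
    intro e f g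
    simp only [Ring.lie_def]
    noncomm_ring
  rw [key, single_mul_single_same, single_mul_mul_single,
    single_mul_single_of_ne _ _ _ _ hij, single_mul_single_of_ne _ _ _ _ hij.symm,
    single_mul_single_of_ne _ _ _ _ hij, single_mul_single_of_ne _ _ _ _ hli,
    single_mul_single_of_ne _ _ _ _ hlj] at h₄
  simpa [h] using h₄

/-- For `m ≥ 3` the radical of `𝔤𝔩ₘ` consists of the scalar matrices, in any characteristic:
an ideal with a non-scalar element contains all elementary matrices off the diagonal. -/
theorem mem_radical_gl_iff (hm : 3 ≤ m) (X : gl k m) :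
    X ∈ LieAlgebra.radical k (gl k m) ↔ ∃ c : k, X = c • (1 : gl k m) := by
  constructor
  · intro hX
    have hno : ¬ ContainsOffDiag (LieAlgebra.radical k (gl k m)) := fun h =>
      not_isSolvable_of_containsOffDiag hm h inferInstance
    have hoff : ∀ Y ∈ LieAlgebra.radical k (gl k m), ∀ i j, i ≠ j → Y i j = 0 := by
      intro Y hY i j hij
      by_contra h
      exact hno (containsOffDiag_of_apply_ne_zero hm hY hij h)
    have hdiag : ∀ i j, X i i = X j j := by
      intro i j
      by_cases hij : i = j
      · rw [hij]
      have h := hoff _ (lie_mem_left k (gl k m) _ _ (single i j 1) hX) i j hij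
      rw [Ring.lie_def, Matrix.sub_apply, mul_single_apply_same, single_mul_apply_same] at h
      simpa [sub_eq_zero] using h
    refine ⟨X ⟨0, by omega⟩ ⟨0, by omega⟩, ?_⟩
    ext i j
    by_cases hij : i = j
    · subst hij
      simp [hdiag i ⟨0, by omega⟩]
    · simp [hoff X hX i j hij, hij]
  · rintro ⟨c, rfl⟩
    refine LieAlgebra.center_le_radical k (gl k m) ?_
    intro Y
    simp [Ring.lie_def]

theorem trace_eq_zero_of_mem_derivedSeries_one {X : gl k m}
    (hX : X ∈ LieAlgebra.derivedSeries k (gl k m) 1) : X.trace = 0 := by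
  rw [← LieSubmodule.mem_toSubmodule, LieAlgebra.derivedSeries_def,
    LieAlgebra.derivedSeriesOfIdeal_succ, LieSubmodule.lieIdeal_oper_eq_linear_span'] at hX
  refine Submodule.span_induction ?_ (trace_zero _ _) ?_ ?_ hX
  · rintro _ ⟨A, _, B, _, rfl⟩
    rw [Ring.lie_def, trace_sub, trace_mul_comm, sub_self]
  · intro A B _ _ hA hB
    rw [trace_add, hA, hB, add_zero]
  · intro t A _ hA
    rw [trace_smul, hA, smul_zero]

/-- The matrices of trace zero are spanned by the elementary matrices off the diagonal and the
differences of diagonal ones. -/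
theorem mem_of_trace_eq_zero (S : Submodule k (gl k m))
    (hoff : ∀ i j, i ≠ j → single i j (1 : k) ∈ S)
    (hdiag : ∀ i j, i ≠ j → single i i (1 : k) - single j j 1 ∈ S) {X : gl k m}
    (hX : X.trace = 0) : X ∈ S := by
  rcases m with _ | m
  · rw [Subsingleton.elim X 0]
    exact S.zero_mem
  have key : X = ∑ i, ∑ j, X i j • (if i = j then single i i (1 : k) - single 0 0 1
      else single i j 1) := by
    have h : ∀ i j, X i j • (if i = j then single i i (1 : k) - single 0 0 1 else single i j 1) =
        single i j (X i j) - if i = j then single 0 0 (X i i) else 0 := by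
      intro i j
      split_ifs with hij
      · subst hij
        simp [smul_sub]
      · simp
    simp only [h, Finset.sum_sub_distrib, Finset.sum_ite_eq, Finset.mem_univ, if_true]
    rw [sum_sum_single X]
    have ht : ∑ i, single 0 0 (X i i) = single (0 : Fin (m + 1)) (0 : Fin (m + 1)) X.trace := by
      rw [trace, ← singleAddMonoidHom_apply]
      simp [map_sum]
    rw [ht, hX, single_zero, sub_zero]
    rfl
  rw [key]
  refine S.sum_mem fun i _ => S.sum_mem fun j _ => S.smul_mem _ ?_
  split_ifs with hij
  · by_cases h0 : i = 0
    · subst h0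
      rw [sub_self]
      exact S.zero_mem
    · exact hdiag i 0 h0
  · exact hoff i j hij

/-- `[𝔤𝔩ₘ, 𝔤𝔩ₘ] = 𝔰𝔩ₘ`. -/
theorem mem_derivedSeries_one_gl_iff (X : gl k m) :
    X ∈ LieAlgebra.derivedSeries k (gl k m) 1 ↔ X ∈ sl k m := by
  change _ ↔ X.trace = 0
  refine ⟨trace_eq_zero_of_mem_derivedSeries_one, fun hX => ?_⟩
  have hlie : ∀ A B : gl k m, ⁅A, B⁆ ∈ LieAlgebra.derivedSeries k (gl k m) 1 := fun A B =>
    LieSubmodule.lie_mem_lie (I := ⊤) (N := ⊤) trivial trivial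
  refine mem_of_trace_eq_zero (LieAlgebra.derivedSeries k (gl k m) 1).toSubmodule ?_ ?_ hX
  · intro i j hij
    have h := hlie (single i i 1) (single i j 1)
    rwa [lie_single_single_of_ne hij.symm, one_mul] at h
  · intro i j _
    simpa [Ring.lie_def] using hlie (single i j 1) (single j i 1)

/-- For `m ≥ 3` the algebra `𝔰𝔩ₘ` is perfect. -/
theorem derivedSeries_two_gl (hm : 3 ≤ m) {X : gl k m}
    (hX : X ∈ LieAlgebra.derivedSeries k (gl k m) 1) :
    X ∈ LieAlgebra.derivedSeries k (gl k m) 2 := by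
  have h₁ := containsOffDiag_derivedSeries (k := k) hm 1
  refine mem_of_trace_eq_zero (LieAlgebra.derivedSeries k (gl k m) 2).toSubmodule
    (containsOffDiag_derivedSeries hm 2) ?_ (trace_eq_zero_of_mem_derivedSeries_one hX)
  intro i j hij
  rw [LieAlgebra.derivedSeries_def, LieAlgebra.derivedSeriesOfIdeal_succ]
  simpa [Ring.lie_def] using LieSubmodule.lie_mem_lie (h₁ i j hij) (h₁ j i hij.symm)

/-- In characteristic two, the commutator of two `2 × 2` matrices of trace zero is scalar. -/
theorem isSolvable_gl [CharP k 2] (hm : m ≤ 2) : LieAlgebra.IsSolvable (gl k m) := by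
  -- Brackets of two elements of trace zero are central, so the third derived subalgebra vanishes.
  refine isSolvable_of_derivedSeries_two_central (k := k) fun X hX => ?_
  rw [← LieSubmodule.mem_toSubmodule, LieAlgebra.derivedSeries_def,
    LieAlgebra.derivedSeriesOfIdeal_succ, LieSubmodule.lieIdeal_oper_eq_linear_span'] at hX
  refine Submodule.span_induction ?_ (zero_lie ·) ?_ ?_ hX
  · rintro _ ⟨A, hA, B, hB, rfl⟩ Y
    have hA := trace_eq_zero_of_mem_derivedSeries_one hA
    have hB := trace_eq_zero_of_mem_derivedSeries_one hB
    have h2 : (2 : k) = 0 := CharTwo.two_eq_zero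
    interval_cases m
    · exact Subsingleton.elim _ _
    · ext i j
      fin_cases i; fin_cases j
      simp [Ring.lie_def, Matrix.mul_apply]
      ring
    · rw [trace_fin_two] at hA hB
      ext i j
      fin_cases i <;> fin_cases j <;>
        simp [Ring.lie_def, Matrix.mul_apply] <;> grind
  · intro A B _ _ hA hB Y
    rw [add_lie, hA, hB, add_zero]
  · intro t A _ hA Y
    rw [smul_lie, hA, smul_zero]

end GeneralLinear

/-! ### The Lie algebra of a nonsingular diagonal form in characteristic two -/

section DiagonalForm

open Matrix

variable {k : Type*} [Field k] {n : ℕ} {d : Fin n → k}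

theorem formLie_coe_lie (A B : formLie (diagonal d)) :
    ((⁅A, B⁆ : formLie (diagonal d)) : gl k n) = (A : gl k n) * B - B * A := rfl

theorem formLie_coe_smul (t : k) (A : formLie (diagonal d)) :
    ((t • A : formLie (diagonal d)) : gl k n) = t • (A : gl k n) := rfl

theorem formLie_coe_add (A B : formLie (diagonal d)) :
    ((A + B : formLie (diagonal d)) : gl k n) = A + B := rfl

variable [CharP k 2]

theorem matrix_sub_eq_add {ι κ : Type*} (A B : Matrix ι κ k) : A - B = A + B := by
  ext i j
  rw [Matrix.sub_apply, Matrix.add_apply, CharTwo.sub_eq_add]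

/-- `X ∈ 𝔬(D)` means that `D X` is symmetric; its diagonal is unrestricted. -/
theorem mem_formLie_diagonal_iff (X : gl k n) :
    X ∈ formLie (diagonal d) ↔ ∀ i j, d i * X i j = d j * X j i := by
  rw [mem_formLie]
  constructor
  · intro h i j
    have hij := congrFun (congrFun h i) j
    rw [Matrix.add_apply, mul_diagonal, diagonal_mul, transpose_apply, Matrix.zero_apply,
      CharTwo.add_eq_zero] at hij
    rw [← hij, mul_comm]
  · intro h
    ext i j
    rw [Matrix.add_apply, mul_diagonal, diagonal_mul, transpose_apply, Matrix.zero_apply,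
      CharTwo.add_eq_zero, h i j, mul_comm]

/-- The element `dⱼ Eᵢⱼ + dᵢ Eⱼᵢ` of `𝔬(D)`. -/
def formOff (d : Fin n → k) (i j : Fin n) : formLie (diagonal d) :=
  ⟨single i j (d j) + single j i (d i), by
    rw [mem_formLie_diagonal_iff]
    intro p q
    simp only [Matrix.add_apply, single_apply]
    split_ifs <;> grind⟩

/-- The element `Eᵢᵢ` of `𝔬(D)`. -/
def formDiag (d : Fin n → k) (i : Fin n) : formLie (diagonal d) :=
  ⟨single i i 1, by
    rw [mem_formLie_diagonal_iff]
    intro p q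
    simp only [single_apply]
    split_ifs <;> grind⟩

theorem formOff_coe (i j : Fin n) :
    (formOff d i j : gl k n) = single i j (d j) + single j i (d i) := rfl

theorem formOff_comm (i j : Fin n) : formOff d i j = formOff d j i :=
  Subtype.ext (add_comm _ _)

theorem lie_formOff_formOff {i j l : Fin n} (hij : i ≠ j) (hjl : j ≠ l) (hil : i ≠ l) :
    ⁅formOff d i j, formOff d j l⁆ = d j • formOff d i l := by
  refine Subtype.ext ?_
  rw [formLie_coe_lie, formLie_coe_smul, formOff_coe, formOff_coe, formOff_coe]
  simp only [add_mul, mul_add, single_mul_single_same]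
  rw [single_mul_single_of_ne _ _ _ _ hjl, single_mul_single_of_ne _ _ _ _ hij,
    single_mul_single_of_ne _ _ _ _ hil, single_mul_single_of_ne _ _ _ _ hjl.symm,
    single_mul_single_of_ne _ _ _ _ hij.symm, single_mul_single_of_ne _ _ _ _ hil.symm]
  rw [matrix_sub_eq_add]
  simp [smul_add, mul_comm]

/-- The ideal contains all the elements `dⱼ Eᵢⱼ + dᵢ Eⱼᵢ` off the diagonal. -/
def ContainsFormOff (I : LieIdeal k (formLie (diagonal d))) : Prop :=
  ∀ p q : Fin n, p ≠ q → formOff d p q ∈ I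

theorem ContainsFormOff.lie_self (hn : 3 ≤ n) (hd : ∀ i, d i ≠ 0)
    {I : LieIdeal k (formLie (diagonal d))} (hI : ContainsFormOff I) :
    ContainsFormOff ⁅I, I⁆ := by
  intro p q hpq
  obtain ⟨r, hrp, hrq⟩ := exists_third hn p q
  have h := LieSubmodule.lie_mem_lie (hI p r hrp.symm) (hI r q hrq)
  rw [lie_formOff_formOff hrp.symm hrq hpq] at h
  simpa [smul_smul, hd r] using (⁅I, I⁆ : LieIdeal k _).smul_mem (d r)⁻¹ h

theorem not_isSolvable_of_containsFormOff (hn : 3 ≤ n) (hd : ∀ i, d i ≠ 0)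
    {I : LieIdeal k (formLie (diagonal d))} (hI : ContainsFormOff I) :
    ¬ LieAlgebra.IsSolvable I := by
  refine not_isSolvable_of_lie_self ContainsFormOff (fun J hJ => hJ.lie_self hn hd) ?_ I hI
  intro h
  have h01 := h ⟨0, by omega⟩ ⟨1, by omega⟩ (by simp)
  rw [LieSubmodule.mem_bot] at h01
  have := congrFun (congrFun (congrArg Subtype.val h01) ⟨0, by omega⟩) ⟨1, by omega⟩
  simp [formOff, hd] at this

theorem containsFormOff_derivedSeries (hn : 3 ≤ n) (hd : ∀ i, d i ≠ 0) (s : ℕ) :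
    ContainsFormOff (LieAlgebra.derivedSeries k (formLie (diagonal d)) s) := by
  induction s with
  | zero => exact fun _ _ _ => trivial
  | succ s ih =>
    rw [LieAlgebra.derivedSeries_def, LieAlgebra.derivedSeriesOfIdeal_succ]
    exact ih.lie_self hn hd

theorem containsFormOff_of_formOff_mem (hd : ∀ i, d i ≠ 0)
    {I : LieIdeal k (formLie (diagonal d))} {i j : Fin n} (hij : i ≠ j)
    (h : formOff d i j ∈ I) : ContainsFormOff I := by
  have hrow : ∀ {a b c : Fin n}, a ≠ b → a ≠ c → formOff d a b ∈ I → formOff d a c ∈ I := by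
    intro a b c hab hac hI
    by_cases hbc : b = c
    · rwa [← hbc]
    have := lie_mem_left k _ I _ (formOff d b c) hI
    rw [lie_formOff_formOff hab hbc hac] at this
    simpa [smul_smul, hd b] using I.smul_mem (d b)⁻¹ this
  intro p q hpq
  by_cases hpi : p = i
  · subst hpi
    exact hrow hij hpq h
  · exact hrow hpi hpq (formOff_comm (d := d) i p ▸ hrow hij (Ne.symm hpi) h)

theorem containsFormOff_of_apply_ne_zero (hd : ∀ i, d i ≠ 0)
    {I : LieIdeal k (formLie (diagonal d))} {X : formLie (diagonal d)} (hX : X ∈ I) {i j : Fin n}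
    (hij : i ≠ j) (h : (X : gl k n) i j ≠ 0) : ContainsFormOff I := by
  refine containsFormOff_of_formOff_mem hd hij ?_
  -- Brackets with `Eᵢᵢ` and `Eⱼⱼ` leave only the entries `(i, j)` and `(j, i)` of `X`, and these are
  -- proportional to those of `dⱼ Eᵢⱼ + dᵢ Eⱼᵢ` because `D X` is symmetric.
  have h₁ := lie_mem_right k _ I (formDiag d i) _ hX
  have h₂ := lie_mem_left k _ I _ (formDiag d j) h₁
  have h₃ := I.smul_mem (d j * ((X : gl k n) i j)⁻¹) h₂
  suffices h₄ : formOff d i j = (d j * ((X : gl k n) i j)⁻¹) •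
      ⁅⁅formDiag d i, X⁆, formDiag d j⁆ from h₄ ▸ h₃
  refine Subtype.ext ?_
  have key : ∀ e f Y : gl k n, (e * Y - Y * e) * f - f * (e * Y - Y * e) =
      e * Y * f - Y * (e * f) - (f * e) * Y + f * Y * e := by
    intro e f Y
    noncomm_ring
  have hsym := (mem_formLie_diagonal_iff (X : gl k n)).1 X.2 i j
  rw [formLie_coe_smul, formLie_coe_lie, formLie_coe_lie, key]
  simp only [formDiag, formOff]
  rw [single_mul_mul_single, single_mul_mul_single, single_mul_single_of_ne _ _ _ _ hij,
    single_mul_single_of_ne _ _ _ _ hij.symm]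
  have hd' := hd j
  have hji : (X : gl k n) j i = d i * (X : gl k n) i j / d j := by
    field_simp
    rw [hsym, mul_comm]
  rw [hji]
  simp only [mul_zero, zero_mul, sub_zero, one_mul, mul_one, smul_add, smul_single, smul_eq_mul]
  congr 2 <;> field_simp

/-- For `n ≥ 3` the radical of `𝔬(D)` consists of the scalar matrices: an ideal with a non-scalar
element contains all `dⱼ Eᵢⱼ + dᵢ Eⱼᵢ` with `i ≠ j`, thanks to the diagonal matrices in `𝔬(D)`. -/
theorem mem_radical_formLie_iff (hn : 3 ≤ n) (hd : ∀ i, d i ≠ 0) (X : formLie (diagonal d)) :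
    X ∈ LieAlgebra.radical k (formLie (diagonal d)) ↔ ∃ c : k, (X : gl k n) = c • (1 : gl k n) := by
  constructor
  · intro hX
    have hno : ¬ ContainsFormOff (LieAlgebra.radical k (formLie (diagonal d))) := fun h =>
      not_isSolvable_of_containsFormOff hn hd h inferInstance
    have hoff : ∀ Y ∈ LieAlgebra.radical k (formLie (diagonal d)), ∀ i j, i ≠ j →
        (Y : gl k n) i j = 0 := by
      intro Y hY i j hij
      by_contra h
      exact hno (containsFormOff_of_apply_ne_zero hd hY hij h)
    have hdiag : ∀ i j, (X : gl k n) i i = (X : gl k n) j j := by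
      intro i j
      by_cases hij : i = j
      · rw [hij]
      have h := hoff _ (lie_mem_left k _ _ _ (formOff d i j) hX) i j hij
      rw [formLie_coe_lie, formOff_coe, Matrix.sub_apply, mul_add, add_mul, Matrix.add_apply,
        Matrix.add_apply, mul_single_apply_same, single_mul_apply_same,
        mul_single_apply_of_ne _ _ _ _ _ (Ne.symm hij),
        single_mul_apply_of_ne _ _ _ _ _ hij, add_zero, add_zero, mul_comm, ← mul_sub] at h
      exact sub_eq_zero.1 ((mul_eq_zero.1 h).resolve_left (hd j))
    refine ⟨(X : gl k n) ⟨0, by omega⟩ ⟨0, by omega⟩, ?_⟩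
    ext i j
    by_cases hij : i = j
    · subst hij
      simp [hdiag i ⟨0, by omega⟩]
    · simp [hoff X hX i j hij, hij]
  · rintro ⟨c, hc⟩
    refine LieAlgebra.center_le_radical k _ ?_
    intro Y
    refine Subtype.ext ?_
    rw [formLie_coe_lie, hc]
    simp

theorem diag_eq_zero_of_mem_derivedSeries_one (hd : ∀ i, d i ≠ 0) {X : formLie (diagonal d)}
    (hX : X ∈ LieAlgebra.derivedSeries k (formLie (diagonal d)) 1) (i : Fin n) :
    (X : gl k n) i i = 0 := by
  rw [← LieSubmodule.mem_toSubmodule, LieAlgebra.derivedSeries_def,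
    LieAlgebra.derivedSeriesOfIdeal_succ, LieSubmodule.lieIdeal_oper_eq_linear_span'] at hX
  refine Submodule.span_induction ?_ rfl ?_ ?_ hX
  · rintro _ ⟨A, _, B, _, rfl⟩
    rw [formLie_coe_lie, Matrix.sub_apply, mul_apply, mul_apply, ← Finset.sum_sub_distrib]
    refine Finset.sum_eq_zero fun j _ => ?_
    have hA := (mem_formLie_diagonal_iff (A : gl k n)).1 A.2 i j
    have hB := (mem_formLie_diagonal_iff (B : gl k n)).1 B.2 i j
    refine (mul_eq_zero.1 (?_ : d i * d j * _ = 0)).resolve_left (mul_ne_zero (hd i) (hd j))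
    linear_combination d j * (B : gl k n) j i * hA - d j * (A : gl k n) j i * hB
  · intro A B _ _ hA hB
    rw [formLie_coe_add, Matrix.add_apply, hA, hB, add_zero]
  · intro t A _ hA
    rw [formLie_coe_smul, Matrix.smul_apply, hA, smul_zero]

/-- The elements of `𝔬(D)` with zero diagonal are spanned by the `dⱼ Eᵢⱼ + dᵢ Eⱼᵢ`, `i ≠ j`. -/
theorem mem_of_diag_eq_zero (hd : ∀ i, d i ≠ 0) {I : LieIdeal k (formLie (diagonal d))}
    (hI : ContainsFormOff I) {X : formLie (diagonal d)} (hX : ∀ i, (X : gl k n) i i = 0) :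
    X ∈ I := by
  have key : X = ∑ i, ∑ j, (if i < j then (X : gl k n) i j / d j else 0) • formOff d i j := by
    refine Subtype.ext ?_
    ext p q
    have hsym := (mem_formLie_diagonal_iff (X : gl k n)).1 X.2 p q
    have hcoe : ∀ f : Fin n → formLie (diagonal d),
        ((∑ i, f i : formLie (diagonal d)) : gl k n) = ∑ i, (f i : gl k n) :=
      fun f => map_sum (formLie (diagonal d)).subtype f Finset.univ
    simp only [hcoe, Matrix.sum_apply, formLie_coe_smul,
      Matrix.smul_apply, formOff_coe, Matrix.add_apply, smul_add, smul_eq_mul,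
      Finset.sum_add_distrib]
    have h₁ : ∑ i, ∑ j, (if i < j then (X : gl k n) i j / d j else 0) * single i j (d j) p q =
        if p < q then (X : gl k n) p q else 0 := by
      rw [Finset.sum_eq_single p, Finset.sum_eq_single q]
      · have := hd q
        split_ifs <;> simp [this]
      · intro b _ hb
        simp [hb]
      · simp
      · intro b _ hb
        simp [hb]
      · simp
    have h₂ : ∑ i, ∑ j, (if i < j then (X : gl k n) i j / d j else 0) * single j i (d i) p q =
        if q < p then (X : gl k n) p q else 0 := by
      rw [Finset.sum_eq_single q, Finset.sum_eq_single p]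
      · have := hd p
        split_ifs
        · simp only [single_apply_same]
          field_simp
          rw [mul_comm, ← hsym]
        · simp
      · intro b _ hb
        simp [hb]
      · simp
      · intro b _ hb
        simp [hb]
      · simp
    rw [h₁, h₂]
    rcases lt_trichotomy p q with h | h | h
    · simp [h, h.not_gt]
    · simp [h, hX]
    · simp [h, h.not_gt]
  rw [key]
  refine sum_mem fun i _ => sum_mem fun j _ => ?_
  by_cases hij : i < j
  · exact I.smul_mem _ (hI i j hij.ne)
  · rw [if_neg hij, zero_smul]
    exact I.zero_mem

/-- For `n ≥ 3` the derived subalgebra of `𝔬(D)` is perfect. -/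
theorem derivedSeries_two_formLie (hn : 3 ≤ n) (hd : ∀ i, d i ≠ 0) {X : formLie (diagonal d)}
    (hX : X ∈ LieAlgebra.derivedSeries k (formLie (diagonal d)) 1) :
    X ∈ LieAlgebra.derivedSeries k (formLie (diagonal d)) 2 :=
  mem_of_diag_eq_zero hd (containsFormOff_derivedSeries hn hd 2)
    (diag_eq_zero_of_mem_derivedSeries_one hd hX)

/-- For `n ≤ 2` the derived subalgebra of `𝔬(D)` is at most one-dimensional. -/
theorem isSolvable_formLie (hn : n ≤ 2) (hd : ∀ i, d i ≠ 0) :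
    LieAlgebra.IsSolvable (formLie (diagonal d)) := by
  rw [LieAlgebra.isSolvable_iff k]
  refine ⟨2, ?_⟩
  rw [LieAlgebra.derivedSeries_def, LieAlgebra.derivedSeriesOfIdeal_succ,
    LieSubmodule.lie_eq_bot_iff]
  intro A hA B hB
  have hA' := diag_eq_zero_of_mem_derivedSeries_one hd hA
  have hB' := diag_eq_zero_of_mem_derivedSeries_one hd hB
  refine Subtype.ext ?_
  rw [formLie_coe_lie]
  interval_cases n
  · exact Subsingleton.elim _ _
  · ext i j
    fin_cases i; fin_cases j
    simp [Matrix.mul_apply]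
    ring
  · have hsA := (mem_formLie_diagonal_iff (A : gl k 2)).1 A.2 0 1
    have hsB := (mem_formLie_diagonal_iff (B : gl k 2)).1 B.2 0 1
    have hcomm : (A : gl k 2) 0 1 * (B : gl k 2) 1 0 = (B : gl k 2) 0 1 * (A : gl k 2) 1 0 := by
      refine mul_left_cancel₀ (mul_ne_zero (hd 0) (hd 1)) ?_
      linear_combination d 1 * (B : gl k 2) 1 0 * hsA - d 1 * (A : gl k 2) 1 0 * hsB
    ext i j
    fin_cases i <;> fin_cases j <;> simp [Matrix.mul_apply, hA', hB']
    · rw [hcomm, sub_self]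
    · rw [sub_eq_zero, mul_comm, ← hcomm, mul_comm]

end DiagonalForm

/-! ### Block decomposition of the Lie algebra of a degenerate form -/

section Blocks

open Matrix

variable {k : Type*} [Field k] {m n : ℕ} {d : Fin n → k}

/-- `𝔬(0ₘ ⊕ D)` consists of the block upper triangular matrices with lower right block in `𝔬(D)`. -/
theorem fromBlocks_mem_formLie_iff (hd : ∀ i, d i ≠ 0) (A : gl k m) (B : Matrix (Fin m) (Fin n) k)
    (C : Matrix (Fin n) (Fin m) k) (E : gl k n) :
    fromBlocks A B C E ∈ formLie (zeroSum m (diagonal d)) ↔ C = 0 ∧ E ∈ formLie (diagonal d) := by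
  rw [mem_formLie, mem_formLie, zeroSum, fromBlocks_transpose, fromBlocks_multiply,
    fromBlocks_multiply, fromBlocks_add]
  simp only [Matrix.mul_zero, Matrix.zero_mul, add_zero, zero_add]
  rw [← fromBlocks_zero, fromBlocks_inj]
  constructor
  · rintro ⟨-, -, hC, hE⟩
    refine ⟨?_, hE⟩
    ext i j
    have h := congrFun (congrFun hC i) j
    rw [diagonal_mul, Matrix.zero_apply] at h
    exact (mul_eq_zero.1 h).resolve_left (hd i)
  · rintro ⟨rfl, hE⟩
    simp [hE]

theorem mem_formLie_zeroSum_iff (hd : ∀ i, d i ≠ 0) (X : Matrix (Fin m ⊕ Fin n) (Fin m ⊕ Fin n) k) :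
    X ∈ formLie (zeroSum m (diagonal d)) ↔
      X.toBlocks₂₁ = 0 ∧ X.toBlocks₂₂ ∈ formLie (diagonal d) := by
  rw [← fromBlocks_mem_formLie_iff hd X.toBlocks₁₁ X.toBlocks₁₂, fromBlocks_toBlocks]

theorem formLie_zeroSum_ext (hd : ∀ i, d i ≠ 0) {X Y : formLie (zeroSum m (diagonal d))}
    (h₁₁ : X.1.toBlocks₁₁ = Y.1.toBlocks₁₁) (h₁₂ : X.1.toBlocks₁₂ = Y.1.toBlocks₁₂)
    (h₂₂ : X.1.toBlocks₂₂ = Y.1.toBlocks₂₂) : X = Y := by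
  have hX := (mem_formLie_zeroSum_iff hd X.1).1 X.2
  have hY := (mem_formLie_zeroSum_iff hd Y.1).1 Y.2
  refine Subtype.ext ?_
  rw [← fromBlocks_toBlocks X.1, ← fromBlocks_toBlocks Y.1, h₁₁, h₁₂, h₂₂, hX.1, hY.1]

/-- The blocks of a commutator in `𝔬(0ₘ ⊕ D)`. -/
theorem toBlocks_lie (hd : ∀ i, d i ≠ 0) (X Y : formLie (zeroSum m (diagonal d))) :
    (⁅X, Y⁆ : formLie (zeroSum m (diagonal d))).1 =
      fromBlocks ⁅X.1.toBlocks₁₁, Y.1.toBlocks₁₁⁆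
        (X.1.toBlocks₁₁ * Y.1.toBlocks₁₂ + X.1.toBlocks₁₂ * Y.1.toBlocks₂₂ -
          (Y.1.toBlocks₁₁ * X.1.toBlocks₁₂ + Y.1.toBlocks₁₂ * X.1.toBlocks₂₂)) 0
        ⁅X.1.toBlocks₂₂, Y.1.toBlocks₂₂⁆ := by
  have hX := ((mem_formLie_zeroSum_iff hd X.1).1 X.2).1
  have hY := ((mem_formLie_zeroSum_iff hd Y.1).1 Y.2).1
  change X.1 * Y.1 - Y.1 * X.1 = _
  conv_lhs => rw [← fromBlocks_toBlocks X.1, ← fromBlocks_toBlocks Y.1, hX, hY]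
  rw [fromBlocks_multiply, fromBlocks_multiply, sub_eq_add_neg, fromBlocks_neg, fromBlocks_add]
  simp [Ring.lie_def, ← sub_eq_add_neg]
  abel

/-- The projection of `𝔬(0ₘ ⊕ D)` to its upper left block. -/
def projGL (hd : ∀ i, d i ≠ 0) : formLie (zeroSum m (diagonal d)) →ₗ⁅k⁆ gl k m where
  toFun X := X.1.toBlocks₁₁
  map_add' _ _ := rfl
  map_smul' _ _ := rfl
  map_lie' := fun {X Y} => by
    change (⁅X, Y⁆ : formLie (zeroSum m (diagonal d))).1.toBlocks₁₁ = _
    rw [toBlocks_lie hd, toBlocks_fromBlocks₁₁]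

/-- The projection of `𝔬(0ₘ ⊕ D)` to its lower right block. -/
def projForm (hd : ∀ i, d i ≠ 0) :
    formLie (zeroSum m (diagonal d)) →ₗ⁅k⁆ formLie (diagonal d) where
  toFun X := ⟨X.1.toBlocks₂₂, ((mem_formLie_zeroSum_iff hd X.1).1 X.2).2⟩
  map_add' _ _ := rfl
  map_smul' _ _ := rfl
  map_lie' := fun {X Y} => by
    refine Subtype.ext ?_
    change (⁅X, Y⁆ : formLie (zeroSum m (diagonal d))).1.toBlocks₂₂ = _
    rw [toBlocks_lie hd, toBlocks_fromBlocks₂₂]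
    rfl

theorem toMatrix'_comp_sub_comp (A A' : gl k m) (E E' : gl k n)
    (φ ψ : (Fin n → k) →ₗ[k] (Fin m → k)) :
    LinearMap.toMatrix' ((A.toLin'.comp ψ - ψ.comp E.toLin') -
        (A'.toLin'.comp φ - φ.comp E'.toLin')) =
      A * LinearMap.toMatrix' ψ + LinearMap.toMatrix' φ * E' -
        (A' * LinearMap.toMatrix' φ + LinearMap.toMatrix' ψ * E) := by
  rw [map_sub, map_sub, map_sub]
  simp only [LinearMap.toMatrix'_comp, LinearMap.toMatrix'_toLin']
  abel

variable {g h : Type*} [LieRing g] [LieAlgebra k g] [LieRing h] [LieAlgebra k h]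

/-- The matrix of an element of `Hom(kⁿ, kᵐ)`, viewed as an abelian Lie algebra. -/
def homMatrix : AbelianLie ((Fin n → k) →ₗ[k] (Fin m → k)) →ₗ[k] Matrix (Fin m) (Fin n) k :=
  (LinearMap.toMatrix' : ((Fin n → k) →ₗ[k] (Fin m → k)) ≃ₗ[k] _).toLinearMap

/-- Homomorphisms `f : g → 𝔤𝔩ₘ` and `f' : h → 𝔬(D)` turn `kᵐ` and `kⁿ` into representations `ρ`
of `g` and `σ` of `h`; the semidirect product of `g ⊕ h` with `Hom(kⁿ, kᵐ)` then maps to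
`𝔬(0ₘ ⊕ D)`, the linear maps `kⁿ → kᵐ` going to the upper right block. -/
def blockHom (hd : ∀ i, d i ≠ 0) (f : g →ₗ⁅k⁆ gl k m) (f' : h →ₗ⁅k⁆ formLie (diagonal d))
    (ρ : g →ₗ⁅k⁆ Module.End k (Fin m → k)) (σ : h →ₗ⁅k⁆ Module.End k (Fin n → k))
    (hρ : ∀ x, ρ x = (f x).toLin') (hσ : ∀ y, σ y = (f' y).1.toLin') :
    Semi (homRep σ ρ) →ₗ⁅k⁆ formLie (zeroSum m (diagonal d)) where
  toFun z := ⟨fromBlocks (f z.right.1) (homMatrix z.left) 0 (f' z.right.2),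
    (fromBlocks_mem_formLie_iff hd _ _ _ _).2 ⟨rfl, (f' z.right.2).2⟩⟩
  map_add' := by
    rintro ⟨φ, x, y⟩ ⟨ψ, x', y'⟩
    refine formLie_zeroSum_ext hd ?_ ?_ ?_
    · exact map_add f x x'
    · exact map_add homMatrix φ ψ
    · exact congrArg Subtype.val (map_add f' y y')
  map_smul' := by
    rintro t ⟨φ, x, y⟩
    refine formLie_zeroSum_ext hd ?_ ?_ ?_
    · exact map_smul f t x
    · exact map_smul homMatrix t φ
    · exact congrArg Subtype.val (map_smul f' t y)
  map_lie' := by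
    rintro ⟨φ, x, y⟩ ⟨ψ, x', y'⟩
    refine Subtype.ext ?_
    rw [toBlocks_lie hd]
    refine fromBlocks_inj.2
      ⟨LieHom.map_lie f x x', ?_, rfl, congrArg Subtype.val (LieHom.map_lie f' y y')⟩
    refine (congrArg (fun z => homMatrix z.left)
      (semi_lie (homRep σ ρ) φ ψ (x, y) (x', y'))).trans ?_
    change LinearMap.toMatrix' (((ρ x).comp _ - LinearMap.comp _ (σ y)) -
      ((ρ x').comp _ - LinearMap.comp _ (σ y'))) = _
    rw [hρ, hρ, hσ, hσ]
    exact toMatrix'_comp_sub_comp _ _ _ _ _ _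

/-- When `f` and `f'` are injective, `blockHom` identifies the semidirect product with any ideal
of `𝔬(0ₘ ⊕ D)` given by conditions on the diagonal blocks that cut out the images of `f`, `f'`. -/
theorem nonempty_idealEquiv_semi (hd : ∀ i, d i ≠ 0)
    (I : LieIdeal k (formLie (zeroSum m (diagonal d))))
    (f : g →ₗ⁅k⁆ gl k m) (f' : h →ₗ⁅k⁆ formLie (diagonal d))
    (ρ : g →ₗ⁅k⁆ Module.End k (Fin m → k)) (σ : h →ₗ⁅k⁆ Module.End k (Fin n → k))
    (hρ : ∀ x, ρ x = (f x).toLin') (hσ : ∀ y, σ y = (f' y).1.toLin')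
    (hf : Function.Injective f) (hf' : Function.Injective f')
    (hI : ∀ X, X ∈ I ↔ (∃ x, f x = projGL hd X) ∧ ∃ y, f' y = projForm hd X) :
    Nonempty (I ≃ₗ⁅k⁆ Semi (homRep σ ρ)) := by
  refine nonempty_idealEquiv (blockHom hd f f' ρ σ hρ hσ) ?_ I ?_
  · rintro ⟨φ, x, y⟩ ⟨ψ, x', y'⟩ hXY
    obtain ⟨h₁, h₂, -, h₃⟩ := fromBlocks_inj.1 (congrArg Subtype.val hXY)
    obtain rfl := hf h₁
    obtain rfl := hf' (Subtype.ext h₃)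
    obtain rfl := LinearMap.toMatrix'.injective h₂
    rfl
  · intro X
    rw [hI]
    constructor
    · rintro ⟨⟨x, hx⟩, ⟨y, hy⟩⟩
      refine ⟨⟨X.1.toBlocks₁₂.toLin', x, y⟩, formLie_zeroSum_ext hd hx ?_ (congrArg Subtype.val hy)⟩
      exact LinearMap.toMatrix'_toLin' _
    · rintro ⟨⟨φ, x, y⟩, rfl⟩
      exact ⟨⟨x, rfl⟩, ⟨y, rfl⟩⟩

/-- The inclusion of `𝔤𝔩ₘ` as the upper left block. -/
def inclGL (hd : ∀ i, d i ≠ 0) : gl k m →ₗ⁅k⁆ formLie (zeroSum m (diagonal d)) where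
  toFun A := ⟨fromBlocks A 0 0 0,
    (fromBlocks_mem_formLie_iff hd _ _ _ _).2 ⟨rfl, zero_mem (formLie (diagonal d))⟩⟩
  map_add' _ _ := Subtype.ext (by simp [fromBlocks_add])
  map_smul' _ _ := Subtype.ext (by simp [fromBlocks_smul])
  map_lie' := Subtype.ext (by simp [toBlocks_lie hd])

/-- The inclusion of `𝔬(D)` as the lower right block. -/
def inclForm (hd : ∀ i, d i ≠ 0) :
    formLie (diagonal d) →ₗ⁅k⁆ formLie (zeroSum m (diagonal d)) where
  toFun E := ⟨fromBlocks 0 0 0 E.1, (fromBlocks_mem_formLie_iff hd _ _ _ _).2 ⟨rfl, E.2⟩⟩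
  map_add' _ _ := Subtype.ext (by simp [fromBlocks_add])
  map_smul' _ _ := Subtype.ext (by simp [fromBlocks_smul])
  map_lie' := Subtype.ext (by simp [toBlocks_lie hd])

/-- The inclusion of the abelian ideal `Hom(kⁿ, kᵐ)` as the upper right block. -/
def inclHom (hd : ∀ i, d i ≠ 0) :
    Matrix (Fin m) (Fin n) k →ₗ[k] formLie (zeroSum m (diagonal d)) where
  toFun B := ⟨fromBlocks 0 B 0 0,
    (fromBlocks_mem_formLie_iff hd _ _ _ _).2 ⟨rfl, zero_mem (formLie (diagonal d))⟩⟩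
  map_add' _ _ := Subtype.ext (by simp [fromBlocks_add])
  map_smul' _ _ := Subtype.ext (by simp [fromBlocks_smul])

theorem lie_inclGL_inclHom (hd : ∀ i, d i ≠ 0) (A : gl k m) (B : Matrix (Fin m) (Fin n) k) :
    ⁅inclGL hd A, inclHom hd B⁆ = inclHom hd (A * B) := by
  refine Subtype.ext ?_
  rw [toBlocks_lie hd]
  simp [inclGL, inclHom]

theorem lie_inclHom_inclForm (hd : ∀ i, d i ≠ 0) (B : Matrix (Fin m) (Fin n) k)
    (E : formLie (diagonal d)) :
    ⁅inclHom hd B, inclForm hd E⁆ = inclHom hd (B * E.1) := by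
  refine Subtype.ext ?_
  rw [toBlocks_lie hd]
  simp [inclForm, inclHom]

theorem projGL_surjective (hd : ∀ i, d i ≠ 0) :
    Function.Surjective (projGL (m := m) hd) :=
  fun A => ⟨inclGL hd A, toBlocks_fromBlocks₁₁ _ _ _ _⟩

theorem projForm_surjective (hd : ∀ i, d i ≠ 0) :
    Function.Surjective (projForm (m := m) hd) :=
  fun E => ⟨inclForm hd E, Subtype.ext (toBlocks_fromBlocks₂₂ _ _ _ _)⟩

/-- The two block projections are jointly surjective. -/
theorem exists_projGL_projForm (hd : ∀ i, d i ≠ 0) (A : gl k m) (E : formLie (diagonal d)) :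
    ∃ X, projGL (m := m) hd X = A ∧ projForm hd X = E :=
  ⟨⟨fromBlocks A 0 0 E.1, (fromBlocks_mem_formLie_iff hd _ _ _ _).2 ⟨rfl, E.2⟩⟩,
    toBlocks_fromBlocks₁₁ _ _ _ _, Subtype.ext (toBlocks_fromBlocks₂₂ _ _ _ _)⟩

theorem mem_radical_formLie_zeroSum_iff (hd : ∀ i, d i ≠ 0)
    (X : formLie (zeroSum m (diagonal d))) :
    X ∈ LieAlgebra.radical k (formLie (zeroSum m (diagonal d))) ↔
      projGL hd X ∈ LieAlgebra.radical k (gl k m) ∧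
        projForm hd X ∈ LieAlgebra.radical k (formLie (diagonal d)) := by
  refine mem_radical_iff_of_pair (projGL hd) (projForm hd) (projGL_surjective hd)
    (projForm_surjective hd) ?_ X
  intro X Y hX hX' hY hY'
  have h₁ : X.1.toBlocks₁₁ = 0 := hX
  have h₂ : X.1.toBlocks₂₂ = 0 := congrArg Subtype.val hX'
  have h₃ : Y.1.toBlocks₁₁ = 0 := hY
  have h₄ : Y.1.toBlocks₂₂ = 0 := congrArg Subtype.val hY'
  refine Subtype.ext ?_
  rw [toBlocks_lie hd, h₁, h₂, h₃, h₄]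
  simp

variable [CharP k 2]

/-- If `m ≥ 3` or `n ≥ 3`, the abelian ideal `Hom(kⁿ, kᵐ)` lies in all derived subalgebras: it is
reproduced by the action of the `Eₚₛ`, or of the `dⱼ Eᵢⱼ + dᵢ Eⱼᵢ`, with distinct indices. -/
theorem inclHom_mem_derivedSeries (hd : ∀ i, d i ≠ 0) (hmn : 3 ≤ m ∨ 3 ≤ n) (s : ℕ)
    (B : Matrix (Fin m) (Fin n) k) :
    inclHom hd B ∈ LieAlgebra.derivedSeries k (formLie (zeroSum m (diagonal d))) s := by
  induction s generalizing B with
  | zero => trivial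
  | succ s ih =>
    rw [LieAlgebra.derivedSeries_def, LieAlgebra.derivedSeriesOfIdeal_succ]
    set I := LieAlgebra.derivedSeriesOfIdeal k (formLie (zeroSum m (diagonal d))) s ⊤ with hI
    have hsingle : ∀ p l, inclHom hd (single p l (1 : k)) ∈ ⁅I, I⁆ := by
      intro p l
      rcases hmn with hm | hn
      · obtain ⟨q, hqp, -⟩ := exists_third hm p p
        have hA : inclGL hd (single p q 1) ∈ I :=
          map_mem_derivedSeries (inclGL hd) (containsOffDiag_derivedSeries hm s p q hqp.symm)
        have h := LieSubmodule.lie_mem_lie hA (ih (single q l 1))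
        rwa [lie_inclGL_inclHom, single_mul_single_same, one_mul] at h
      · obtain ⟨j, hjl, -⟩ := exists_third hn l l
        have hE : inclForm hd (formOff d j l) ∈ I :=
          map_mem_derivedSeries (inclForm hd) (containsFormOff_derivedSeries hn hd s j l hjl)
        have h := LieSubmodule.lie_mem_lie (ih (single p j (d l)⁻¹)) hE
        rw [lie_inclHom_inclForm, formOff_coe, Matrix.mul_add, single_mul_single_same,
          single_mul_single_of_ne _ _ _ _ hjl, add_zero, inv_mul_cancel₀ (hd l)] at h
        exact h
    have key : inclHom hd B = ∑ p, ∑ l, B p l • inclHom hd (single p l (1 : k)) := by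
      simp only [← map_smul, ← map_sum, smul_single, smul_eq_mul, mul_one]
      rw [sum_sum_single B]
      rfl
    rw [key]
    exact sum_mem fun p _ => sum_mem fun l _ => (⁅I, I⁆ : LieIdeal k _).smul_mem _ (hsingle p l)

theorem mem_derivedSeries_formLie_zeroSum_iff (hd : ∀ i, d i ≠ 0) (hmn : 3 ≤ m ∨ 3 ≤ n) (s : ℕ)
    (X : formLie (zeroSum m (diagonal d))) :
    X ∈ LieAlgebra.derivedSeries k (formLie (zeroSum m (diagonal d))) s ↔
      projGL hd X ∈ LieAlgebra.derivedSeries k (gl k m) s ∧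
        projForm hd X ∈ LieAlgebra.derivedSeries k (formLie (diagonal d)) s := by
  refine ⟨fun hX => ⟨map_mem_derivedSeries _ hX, map_mem_derivedSeries _ hX⟩, fun hX => ?_⟩
  have key : X = inclGL hd (projGL hd X) + inclHom hd X.1.toBlocks₁₂ +
      inclForm hd (projForm hd X) := by
    refine formLie_zeroSum_ext hd ?_ ?_ ?_
    · change X.1.toBlocks₁₁ = X.1.toBlocks₁₁ + 0 + 0
      rw [add_zero, add_zero]
    · change X.1.toBlocks₁₂ = 0 + X.1.toBlocks₁₂ + 0
      rw [add_zero, zero_add]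
    · change X.1.toBlocks₂₂ = 0 + 0 + X.1.toBlocks₂₂
      rw [add_zero, zero_add]
  rw [key]
  exact add_mem (add_mem (map_mem_derivedSeries _ hX.1) (inclHom_mem_derivedSeries hd hmn s _))
    (map_mem_derivedSeries _ hX.2)

end Blocks

/-! ### Scalars and semisimple quotients -/

section Scalars

open Matrix

variable {k : Type*} [Field k] {m n : ℕ} {d : Fin n → k}

/-- The embedding of `𝔤𝔩₁` into `𝔤𝔩ₘ` as the scalar matrices. -/
def scalarGL (k : Type*) [Field k] (m : ℕ) : gl k 1 →ₗ⁅k⁆ gl k m where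
  toFun x := x 0 0 • (1 : gl k m)
  map_add' x y := by rw [Matrix.add_apply, add_smul]
  map_smul' t x := by rw [Matrix.smul_apply, smul_eq_mul, mul_smul, RingHom.id_apply]
  map_lie' := fun {x y} => by
    simp [Ring.lie_def, Matrix.mul_apply, mul_comm (x 0 0) (y 0 0), smul_comm (x 0 0) (y 0 0)]

theorem scalarGL_injective (hm : 1 ≤ m) : Function.Injective (scalarGL k m) := by
  intro x y hxy
  have h := congrFun (congrFun hxy ⟨0, hm⟩) ⟨0, hm⟩
  have h' : x 0 0 = y 0 0 := by simpa [scalarGL] using h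
  ext i j
  rw [Subsingleton.elim i 0, Subsingleton.elim j 0, h']

theorem exists_scalarGL_iff (X : gl k m) :
    (∃ x, scalarGL k m x = X) ↔ ∃ c : k, X = c • (1 : gl k m) := by
  constructor
  · rintro ⟨x, rfl⟩
    exact ⟨x 0 0, rfl⟩
  · rintro ⟨c, rfl⟩
    exact ⟨fun _ _ => c, rfl⟩

/-- The copies `k₁^{⊕ m}` of the one-dimensional representation of `𝔤𝔩₁` are the restriction of
the vector representation of `𝔤𝔩ₘ` to the scalar matrices. -/
theorem powRep_charRep_one (x : gl k 1) :
    powRep (charRep (1 : k)) m x = (scalarGL k m x).toLin' := by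
  refine LinearMap.ext fun v => funext fun i => ?_
  rw [toLin'_apply]
  change (x 0 0 * 1) • v i = (x 0 0 • (1 : gl k m)).mulVec v i
  rw [smul_mulVec, one_mulVec, mul_one]
  rfl

/-- The projection `X ↦ X - tr(X)` of `𝔤𝔩ₘ` onto `𝔰𝔩ₘ` along the scalar matrices, when `m = 1` in
`k`; in characteristic two this covers all odd `m`. -/
def projSL (hm : (m : k) = 1) : gl k m →ₗ⁅k⁆ sl k m where
  toFun X := ⟨X - X.trace • (1 : gl k m), by
    change (X - X.trace • (1 : gl k m)).trace = 0
    rw [trace_sub, trace_smul, trace_one, Fintype.card_fin, hm, smul_eq_mul, mul_one, sub_self]⟩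
  map_add' X Y := Subtype.ext (by
    change X + Y - (X + Y).trace • (1 : gl k m) =
      (X - X.trace • (1 : gl k m)) + (Y - Y.trace • (1 : gl k m))
    rw [trace_add, add_smul]
    abel)
  map_smul' t X := Subtype.ext (by
    change t • X - (t • X).trace • (1 : gl k m) = t • (X - X.trace • (1 : gl k m))
    rw [trace_smul, smul_eq_mul, smul_sub, smul_smul])
  map_lie' := fun {X Y} => Subtype.ext (by
    change ⁅X, Y⁆ - (⁅X, Y⁆).trace • (1 : gl k m) =
      ⁅X - X.trace • (1 : gl k m), Y - Y.trace • (1 : gl k m)⁆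
    rw [Ring.lie_def, Ring.lie_def, trace_sub, trace_mul_comm, sub_self, zero_smul, sub_zero]
    simp only [sub_mul, mul_sub, smul_mul_assoc, mul_smul_comm, one_mul, mul_one]
    rw [smul_sub, smul_sub, smul_comm X.trace Y.trace]
    abel)

theorem projSL_surjective (hm : (m : k) = 1) : Function.Surjective (projSL hm) := by
  intro X
  refine ⟨X.1, Subtype.ext ?_⟩
  have hX : X.1.trace = 0 := X.2
  change X.1 - X.1.trace • (1 : gl k m) = X.1
  rw [hX, zero_smul, sub_zero]

theorem projSL_eq_zero_iff (hm : (m : k) = 1) (X : gl k m) :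
    projSL hm X = 0 ↔ ∃ c : k, X = c • (1 : gl k m) := by
  have h : projSL hm X = 0 ↔ X - X.trace • (1 : gl k m) = 0 :=
    ⟨congrArg Subtype.val, fun h => Subtype.ext h⟩
  rw [h, sub_eq_zero]
  refine ⟨fun h => ⟨_, h⟩, ?_⟩
  rintro ⟨c, rfl⟩
  rw [trace_smul, trace_one, Fintype.card_fin, hm, smul_eq_mul, mul_one]

/-- Surjections of `𝔤𝔩ₘ` and `𝔬(D)` whose kernels are the radicals identify the semisimple quotient
of `𝔬(0ₘ ⊕ D)` with the product of their targets. -/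
theorem nonempty_ssQuotEquiv {g h : Type*} [LieRing g] [LieAlgebra k g] [LieRing h]
    [LieAlgebra k h] (hd : ∀ i, d i ≠ 0) (f : gl k m →ₗ⁅k⁆ g) (f' : formLie (diagonal d) →ₗ⁅k⁆ h)
    (hf : Function.Surjective f) (hf' : Function.Surjective f')
    (hker : ∀ A, A ∈ LieAlgebra.radical k (gl k m) ↔ f A = 0)
    (hker' : ∀ E, E ∈ LieAlgebra.radical k (formLie (diagonal d)) ↔ f' E = 0) :
    Nonempty (SSQuot k (formLie (zeroSum m (diagonal d))) ≃ₗ⁅k⁆ g × h) := by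
  refine nonempty_quotEquiv ((f.comp (projGL hd)).prod (f'.comp (projForm hd))) ?_ _ ?_
  · rintro ⟨a, e⟩
    obtain ⟨A, rfl⟩ := hf a
    obtain ⟨E, rfl⟩ := hf' e
    obtain ⟨X, rfl, rfl⟩ := exists_projGL_projForm hd A E
    exact ⟨X, rfl⟩
  · intro X
    rw [mem_radical_formLie_zeroSum_iff hd, hker, hker']
    exact (Prod.mk_eq_zero (x := f (projGL hd X)) (y := f' (projForm hd X))).symm

variable [CharP k 2]

/-- The embedding of `𝔤𝔩₁` into `𝔬(D)` as the scalar matrices, which exists since the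
characteristic is two. -/
def scalarForm (d : Fin n → k) : gl k 1 →ₗ⁅k⁆ formLie (diagonal d) where
  toFun x := ⟨scalarGL k n x, (formLie (diagonal d)).smul_mem (x 0 0) (one_mem_formLie _)⟩
  map_add' x y := Subtype.ext (map_add (scalarGL k n) x y)
  map_smul' t x := Subtype.ext (map_smul (scalarGL k n) t x)
  map_lie' := fun {x y} => Subtype.ext (LieHom.map_lie (scalarGL k n) x y)

theorem scalarForm_injective (hn : 1 ≤ n) : Function.Injective (scalarForm d) :=
  fun _ _ hxy => scalarGL_injective hn (congrArg Subtype.val hxy)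

theorem exists_scalarForm_iff (X : formLie (diagonal d)) :
    (∃ x, scalarForm d x = X) ↔ ∃ c : k, (X : gl k n) = c • (1 : gl k n) := by
  rw [← exists_scalarGL_iff]
  exact exists_congr fun x => Subtype.ext_iff

end Scalars

end DegForm

end

open DegForm in
theorem mainTheorem5 (k : Type*) [Field k] [CharP k 2] (m n : ℕ) (hm : 1 ≤ m) (hn : 1 ≤ n)
    (D : Matrix (Fin n) (Fin n) k) (hdiag : D.IsDiag) (hdet : D.det ≠ 0) :
    -- the radical
    ((m ≤ 2 → n ≤ 2 →
        Nonempty (LieAlgebra.radical k (formLie (zeroSum m D)) ≃ₗ⁅k⁆ formLie (zeroSum m D))) ∧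
      (3 ≤ m → n ≤ 2 →
        Nonempty (LieAlgebra.radical k (formLie (zeroSum m D)) ≃ₗ⁅k⁆
          Semi (homRep (vecRes (formLie D)) (powRep (charRep (1 : k)) m)))) ∧
      (m ≤ 2 → 3 ≤ n →
        Nonempty (LieAlgebra.radical k (formLie (zeroSum m D)) ≃ₗ⁅k⁆
          Semi (homRep (powRep (charRep (1 : k)) n) (vecGL k m)))) ∧
      (3 ≤ m → 3 ≤ n →
        Nonempty (LieAlgebra.radical k (formLie (zeroSum m D)) ≃ₗ⁅k⁆
          Semi (homRep (powRep (charRep (1 : k)) n) (powRep (charRep (1 : k)) m))))) ∧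
    -- the semisimple quotient
    (Nonempty (SSQuot k (formLie (zeroSum m D)) ≃ₗ⁅k⁆
        SSQuot k (gl k m) × SSQuot k (formLie D)) ∧
      (3 ≤ m → 3 ≤ n → 2 ∣ m →
        Nonempty (SSQuot k (formLie (zeroSum m D)) ≃ₗ⁅k⁆
          pgl k m × (formLie D ⧸ formScalars D))) ∧
      (3 ≤ m → 3 ≤ n → ¬ 2 ∣ m →
        Nonempty (SSQuot k (formLie (zeroSum m D)) ≃ₗ⁅k⁆
          sl k m × (formLie D ⧸ formScalars D)))) ∧
    -- the derived series
    ((3 ≤ m ∨ 3 ≤ n → ∀ i : ℕ, 1 ≤ i →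
        Nonempty (LieAlgebra.derivedSeries k (formLie (zeroSum m D)) i ≃ₗ⁅k⁆
          Semi (homRep (vecDer (formLie D) i) (vecDer (sl k m) (i - 1))))) ∧
      (3 ≤ m → 3 ≤ n →
        Nonempty (LieAlgebra.derivedSeries k (formLie (zeroSum m D)) 1 ≃ₗ⁅k⁆
          Semi (homRep (vecDer (formLie D) 1) (vecRes (sl k m)))) ∧
        LieAlgebra.derivedSeries k (formLie (zeroSum m D)) 2 =
          LieAlgebra.derivedSeries k (formLie (zeroSum m D)) 1)) ∧
    -- solvability
    (LieAlgebra.IsSolvable (formLie (zeroSum m D)) ↔ m ≤ 2 ∧ n ≤ 2) := by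
  obtain ⟨d, rfl⟩ : ∃ d, D = Matrix.diagonal d := ⟨_, hdiag.diagonal_diag.symm⟩
  have hd : ∀ i, d i ≠ 0 := by
    rw [Matrix.det_diagonal] at hdet
    exact fun i => Finset.prod_ne_zero_iff.1 hdet i (Finset.mem_univ i)
  have hrad := mem_radical_formLie_zeroSum_iff (m := m) hd
  have hGL : m ≤ 2 → ∀ A, A ∈ LieAlgebra.radical k (gl k m) := fun h =>
    isSolvable_iff_forall_mem_radical.1 (isSolvable_gl h)
  have hForm : n ≤ 2 → ∀ E, E ∈ LieAlgebra.radical k (formLie (Matrix.diagonal d)) := fun h =>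
    isSolvable_iff_forall_mem_radical.1 (isSolvable_formLie h hd)
  -- The index is shifted by one, so that no truncated subtraction occurs.
  have hder : 3 ≤ m ∨ 3 ≤ n → ∀ i : ℕ,
      Nonempty (LieAlgebra.derivedSeries k (formLie (zeroSum m (Matrix.diagonal d))) (i + 1) ≃ₗ⁅k⁆
        Semi (homRep (vecDer (formLie (Matrix.diagonal d)) (i + 1)) (vecDer (sl k m) i))) := by
    intro hmn i
    refine nonempty_idealEquiv_semi hd _
      ((sl k m).incl.comp (LieAlgebra.derivedSeries k (sl k m) i).incl)
      (LieAlgebra.derivedSeries k (formLie (Matrix.diagonal d)) (i + 1)).incl _ _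
      (fun _ => rfl) (fun _ => rfl) ?_ ?_ ?_
    · exact fun x y hxy => Subtype.ext (Subtype.ext hxy)
    · exact fun x y hxy => Subtype.ext hxy
    · intro X
      rw [mem_derivedSeries_formLie_zeroSum_iff hd hmn,
        mem_derivedSeries_succ_iff (sl k m) mem_derivedSeries_one_gl_iff]
      refine and_congr ⟨?_, ?_⟩ ⟨?_, ?_⟩
      · exact fun ⟨y, hy, h⟩ => ⟨⟨y, hy⟩, h⟩
      · exact fun ⟨y, h⟩ => ⟨y.1, y.2, h⟩
      · exact fun h => ⟨⟨_, h⟩, rfl⟩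
      · exact fun ⟨y, h⟩ => h ▸ y.2
  refine ⟨⟨?_, ?_, ?_, ?_⟩, ⟨?_, ?_, ?_⟩, ⟨?_, ?_⟩, ?_⟩
  · intro hm2 hn2
    exact nonempty_idealEquiv (LieEquiv.refl (R := k)).toLieHom (fun _ _ h => h) _
      fun X => ⟨fun _ => ⟨X, rfl⟩, fun _ => (hrad X).2 ⟨hGL hm2 _, hForm hn2 _⟩⟩
  · intro hm3 hn2
    refine nonempty_idealEquiv_semi hd _ (scalarGL k m) LieHom.id _ _ powRep_charRep_one
      (fun _ => rfl) (scalarGL_injective hm) (fun _ _ h => h) fun X => ?_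
    rw [hrad, mem_radical_gl_iff hm3, exists_scalarGL_iff]
    exact and_congr_right fun _ => ⟨fun _ => ⟨_, rfl⟩, fun _ => hForm hn2 _⟩
  · intro hm2 hn3
    refine nonempty_idealEquiv_semi hd _ LieHom.id (scalarForm d) _ _ (fun _ => rfl)
      powRep_charRep_one (fun _ _ h => h) (scalarForm_injective hn) fun X => ?_
    rw [hrad, mem_radical_formLie_iff hn3 hd, exists_scalarForm_iff]
    exact and_congr_left fun _ => ⟨fun _ => ⟨_, rfl⟩, fun _ => hGL hm2 _⟩
  · intro hm3 hn3
    refine nonempty_idealEquiv_semi hd _ (scalarGL k m) (scalarForm d) _ _ powRep_charRep_one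
      powRep_charRep_one (scalarGL_injective hm) (scalarForm_injective hn) fun X => ?_
    rw [hrad, mem_radical_gl_iff hm3, mem_radical_formLie_iff hn3 hd, exists_scalarGL_iff,
      exists_scalarForm_iff]
  · exact nonempty_ssQuotEquiv hd (quotHom _) (quotHom _) (quotHom_surjective _)
      (quotHom_surjective _) (mem_iff_quotHom_eq_zero _) (mem_iff_quotHom_eq_zero _)
  · intro hm3 hn3 _
    exact nonempty_ssQuotEquiv hd (quotHom (scalars k m))
      (quotHom (formScalars (Matrix.diagonal d))) (quotHom_surjective _) (quotHom_surjective _)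
      (fun A => (mem_radical_gl_iff hm3 A).trans (mem_iff_quotHom_eq_zero (scalars k m) A))
      (fun E => (mem_radical_formLie_iff hn3 hd E).trans
        (mem_iff_quotHom_eq_zero (formScalars (Matrix.diagonal d)) E))
  · intro hm3 hn3 hodd
    have hm1 : (m : k) = 1 := by
      obtain ⟨r, rfl⟩ : ∃ r, m = 2 * r + 1 := ⟨m / 2, by omega⟩
      push_cast
      rw [CharTwo.two_eq_zero, zero_mul, zero_add]
    exact nonempty_ssQuotEquiv hd (projSL hm1)
      (quotHom (formScalars (Matrix.diagonal d))) (projSL_surjective hm1) (quotHom_surjective _)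
      (fun A => (mem_radical_gl_iff hm3 A).trans (projSL_eq_zero_iff hm1 A).symm)
      (fun E => (mem_radical_formLie_iff hn3 hd E).trans
        (mem_iff_quotHom_eq_zero (formScalars (Matrix.diagonal d)) E))
  · rintro hmn (_ | i) hi
    · omega
    · exact hder hmn i
  · intro hm3 hn3
    constructor
    · refine nonempty_idealEquiv_semi hd _ (sl k m).incl
        (LieAlgebra.derivedSeries k (formLie (Matrix.diagonal d)) 1).incl _ _
        (fun _ => rfl) (fun _ => rfl) (fun x y hxy => Subtype.ext hxy)
        (fun x y hxy => Subtype.ext hxy) fun X => ?_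
      rw [mem_derivedSeries_formLie_zeroSum_iff hd (Or.inl hm3), mem_derivedSeries_one_gl_iff]
      refine and_congr ⟨?_, ?_⟩ ⟨?_, ?_⟩
      · exact fun h => ⟨⟨_, h⟩, rfl⟩
      · exact fun ⟨y, h⟩ => h ▸ y.2
      · exact fun h => ⟨⟨_, h⟩, rfl⟩
      · exact fun ⟨y, h⟩ => h ▸ y.2
    · refine le_antisymm (LieAlgebra.derivedSeriesOfIdeal_succ_le _ 1) fun X hX => ?_
      rw [mem_derivedSeries_formLie_zeroSum_iff hd (Or.inl hm3)] at hX ⊢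
      exact ⟨derivedSeries_two_gl hm3 hX.1, derivedSeries_two_formLie hn3 hd hX.2⟩
  · constructor
    · intro hsol
      have hGL' : LieAlgebra.IsSolvable (gl k m) :=
        (projGL_surjective (m := m) hd).lieAlgebra_isSolvable
      have hForm' : LieAlgebra.IsSolvable (formLie (Matrix.diagonal d)) :=
        (projForm_surjective (m := m) hd).lieAlgebra_isSolvable
      constructor
      · by_contra h
        exact not_isSolvable_of_containsOffDiag (by omega) (I := (⊤ : LieIdeal k (gl k m)))
          (fun _ _ _ => trivial) inferInstance
      · by_contra h
        exact not_isSolvable_of_containsFormOff (by omega) hd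
          (I := (⊤ : LieIdeal k (formLie (Matrix.diagonal d)))) (fun _ _ _ => trivial) inferInstance
    · rintro ⟨hm2, hn2⟩
      exact isSolvable_iff_forall_mem_radical.2 fun X => (hrad X).2 ⟨hGL hm2 _, hForm hn2 _⟩
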